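/- **Definitions.** A semigroup presentation $\mathcal P=\langle\Sigma\mid\mathcal R\rangle$ consists of an alphabet $\Sigma$ (an arbitrary set) and a set $\mathcal R$ of relations $u=v$ between nonempty words over $\Sigma$, such that if $u=v$ belongs to $\mathcal R$ then $v=u$ does not (in particular no relation has the form $u=u$). Its Squier square complex $S(\mathcal P)$ has the nonempty words over $\Sigma$ as vertices; an edge $[a,u=v,b]$ between $aub$ and $avb$ for every relation $u=v$ in $\mathcal R$ and all (possibly empty) words $a,b$; and, for all relations $u=v$, $p=q$ in $\mathcal R$ and all (possibly empty) words $a,b,c$, a square bounded by the edges $[a,u=v,bpc]$, $[avb,p=q,c]$, $[a,u=v,bqc]$, $[aub,p=q,c]$. For a nonempty word $w$ over $\Sigma$, the diagram group $D(\mathcal P,w)$ is the fundamental group of $S(\mathcal P)$ based at $w$. A group is a diagram group if it is isomorphic to some $D(\mathcal P,w)$. For a simplicial graph $\Gamma$ (possibly infinite), the right-angled Artin group $A(\Gamma)$ is $\langle V(\Gamma)\mid uv=vu \text{ for } \{u,v\}\in E(\Gamma)\rangle$. Thompson's group $F$ is the group of increasing piecewise linear homeomorphisms $[0,1]\to[0,1]$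 with finitely many breakpoints, whose breakpoints have dyadic coordinates and whose slopes are powers of $2$. **Theorem.** For every diagram group $G$ there exist a simplicial graph $\Gamma$, a subgroup $R$ of the right-angled Artin group $A(\Gamma)$, a subgroup $S$ of Thompson's group $F$, and a short exact sequence of groups $$1\to R\to G\to S\to 1.$$ -/

import Mathlib

universe u v

/-- A semigroup presentation with alphabet `α`: a set of relations `u = v` (stored as pairs
`(u, v)`) between nonempty words, such that `u = v` and `v = u` are never both listed
(so that in particular no relation has the form `u = u`). -/
structure SemigroupPresentation (α : Type*) where
  rels : Set (List α × List α)
  lhs_ne_nil : ∀ r ∈ rels, r.1 ≠ []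
  rhs_ne_nil : ∀ r ∈ rels, r.2 ≠ []
  not_swap_mem : ∀ r ∈ rels, r.swap ∉ rels

namespace SemigroupPresentation

open CategoryTheory

/-- The vertices of the Squier complex of `P`: the words over the alphabet. (The empty word is an
isolated vertex, since both sides of a relation are nonempty; all other vertices are the
positive words.) -/
def Vertex {α : Type*} (_P : SemigroupPresentation α) : Type _ := List α

/-- The edges `[a, u = v, b]` of the Squier complex, oriented from `aub` to `avb`, where `u = v` is
a relation of `P` and `a`, `b` are possibly empty words. -/
structure Edge {α : Type*} (P : SemigroupPresentation α) (x y : List α) where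
  pre : List α
  rel : P.rels
  suf : List α
  source_eq : x = pre ++ rel.1.1 ++ suf
  target_eq : y = pre ++ rel.1.2 ++ suf

/-- The oriented one-skeleton of the Squier complex. -/
instance {α : Type*} (P : SemigroupPresentation α) : Quiver P.Vertex where
  Hom x y := P.Edge x y

/-- The fundamental groupoid of the one-skeleton of the Squier complex: edge paths (edges may be
followed in both directions) modulo insertion and removal of backtracks. -/
abbrev SkeletonGroupoid {α : Type*} (P : SemigroupPresentation α) := Quiver.FreeGroupoid P.Vertex

/-- The class of an edge in the fundamental groupoid of the one-skeleton. -/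
def edgeClass {α : Type*} (P : SemigroupPresentation α) {x y : List α} (e : P.Edge x y) :
    (Quiver.FreeGroupoid.of P.Vertex).obj x ⟶ (Quiver.FreeGroupoid.of P.Vertex).obj y :=
  (Quiver.FreeGroupoid.of P.Vertex).map e

/-- The squares `[a, u = v, b, p = q, c]` of the Squier complex (here `r` is `u = v` and `s` is
`p = q`): the two edge paths `aubpc → avbpc → avbqc` and `aubpc → aubqc → avbqc` around the
square are identified. -/
inductive SquareRel {α : Type*} (P : SemigroupPresentation α) : HomRel P.SkeletonGroupoid
  | square (a : List α) (r : P.rels) (b : List α) (s : P.rels) (c : List α)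
      {x y y' z : List α} (e₁ : P.Edge x y) (e₂ : P.Edge y z) (e₁' : P.Edge x y') (e₂' : P.Edge y' z)
      (h₁ : e₁.pre = a ∧ e₁.rel = r ∧ e₁.suf = b ++ s.1.1 ++ c)
      (h₂ : e₂.pre = a ++ r.1.2 ++ b ∧ e₂.rel = s ∧ e₂.suf = c)
      (h₁' : e₁'.pre = a ++ r.1.1 ++ b ∧ e₁'.rel = s ∧ e₁'.suf = c)
      (h₂' : e₂'.pre = a ∧ e₂'.rel = r ∧ e₂'.suf = b ++ s.1.2 ++ c) :
      SquareRel P (P.edgeClass e₁ ≫ P.edgeClass e₂) (P.edgeClass e₁' ≫ P.edgeClass e₂')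

/-- The fundamental groupoid of the Squier square complex: edge paths modulo backtracks and
flips of squares. -/
abbrev SquierGroupoid {α : Type*} (P : SemigroupPresentation α) :=
  CategoryTheory.Quotient P.SquareRel

/-- A word as an object of the fundamental groupoid of the Squier square complex. -/
def basepoint {α : Type*} (P : SemigroupPresentation α) (w : List α) : P.SquierGroupoid :=
  ⟨(Quiver.FreeGroupoid.of P.Vertex).obj w⟩

/-- The diagram group `D(P, w)`: the fundamental group, based at `w`, of the Squier square complex
of `P`, i.e. the vertex group at `w` of its fundamental groupoid. -/
abbrev DiagramGroup {α : Type*} (P : SemigroupPresentation α) (w : List α) :=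
  P.basepoint w ⟶ P.basepoint w

end SemigroupPresentation

/-- `G` is a diagram group: it is isomorphic to `D(P, w)` for some semigroup presentation `P` and
some nonempty baseword `w`. -/
def IsDiagramGroup (G : Type v) [Group G] : Prop :=
  ∃ (α : Type u) (P : SemigroupPresentation α) (w : List α),
    w ≠ [] ∧ Nonempty (G ≃* P.DiagramGroup w)

/-- The right-angled Artin group of a simplicial graph: one generator for each vertex, and adjacent
vertices commute. -/
abbrev RightAngledArtinGroup {V : Type*} (Γ : SimpleGraph V) :=
  PresentedGroup {c : FreeGroup V | ∃ a b, Γ.Adj a b ∧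
    c = FreeGroup.of a * FreeGroup.of b * (FreeGroup.of a)⁻¹ * (FreeGroup.of b)⁻¹}

/-- Dyadic rational numbers. -/
def IsDyadic (x : ℝ) : Prop := ∃ (m : ℤ) (n : ℕ), x = m / 2 ^ n

theorem IsDyadic.zero : IsDyadic 0 := ⟨0, 0, by simp⟩

theorem IsDyadic.add {x y : ℝ} (hx : IsDyadic x) (hy : IsDyadic y) : IsDyadic (x + y) := by
  obtain ⟨m, n, rfl⟩ := hx
  obtain ⟨m', n', rfl⟩ := hy
  refine ⟨m * 2 ^ n' + m' * 2 ^ n, n + n', ?_⟩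
  push_cast
  rw [pow_add]
  field_simp

theorem IsDyadic.neg {x : ℝ} (hx : IsDyadic x) : IsDyadic (-x) := by
  obtain ⟨m, n, rfl⟩ := hx
  exact ⟨-m, n, by push_cast; ring⟩

theorem IsDyadic.sub {x y : ℝ} (hx : IsDyadic x) (hy : IsDyadic y) : IsDyadic (x - y) := by
  rw [sub_eq_add_neg]; exact hx.add hy.neg

theorem IsDyadic.zpow_mul {x : ℝ} (hx : IsDyadic x) (k : ℤ) : IsDyadic (2 ^ k * x) := by
  obtain ⟨m, n, rfl⟩ := hx
  obtain ⟨k, rfl | rfl⟩ := k.eq_nat_or_neg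
  · exact ⟨2 ^ k * m, n, by push_cast; rw [zpow_natCast]; ring⟩
  · refine ⟨m, n + k, ?_⟩
    rw [zpow_neg, zpow_natCast, pow_add]
    field_simp

/-- `f` is an increasing piecewise linear homeomorphism of `[0, 1]` whose breakpoints have dyadic
coordinates and whose slopes are powers of `2`: there is a finite set `B` such that the points
`(b, f b)`, `b ∈ B`, have dyadic coordinates, and `f` is affine with slope a power of `2` on every
interval whose interior does not meet `B`. -/
structure IsThompson (f : unitInterval ≃ₜ unitInterval) : Prop where
  strictMono : StrictMono f
  piecewise : ∃ B : Finset unitInterval,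
    (∀ b ∈ B, IsDyadic b ∧ IsDyadic (f b)) ∧
    ∀ x y : unitInterval, x < y → (∀ b ∈ B, b ∉ Set.Ioo x y) →
      ∃ k : ℤ, ∀ t ∈ Set.Icc x y, (f t : ℝ) = f x + 2 ^ k * ((t : ℝ) - x)

theorem IsThompson.map_zero {f : unitInterval ≃ₜ unitInterval} (hf : IsThompson f) : f 0 = 0 := by
  obtain ⟨a, ha⟩ := f.surjective 0
  have h : f 0 ≤ f a := hf.strictMono.monotone unitInterval.nonneg'
  exact le_antisymm (h.trans_eq ha) unitInterval.nonneg'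

theorem IsThompson.dyadic_iff {f : unitInterval ≃ₜ unitInterval} (hf : IsThompson f)
    (x : unitInterval) : IsDyadic x ↔ IsDyadic (f x) := by
  obtain ⟨B, hB, h⟩ := hf.piecewise
  obtain ⟨b, hb, hbx⟩ : ∃ b ∈ (insert 0 B).filter (· ≤ x), ∀ c ∈ (insert 0 B).filter (· ≤ x),
      c ≤ b :=
    ⟨_, Finset.max'_mem _ ⟨0, by simp⟩, fun c hc => Finset.le_max' _ c hc⟩
  simp only [Finset.mem_filter, Finset.mem_insert] at hb hbx
  have hd : IsDyadic b ∧ IsDyadic (f b) := by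
    rcases hb.1 with h0 | h0
    · rw [h0, hf.map_zero]
      exact ⟨by simpa using IsDyadic.zero, by simpa using IsDyadic.zero⟩
    · exact hB b h0
  rcases hb.2.eq_or_lt with h0 | h0
  · rw [← h0]; simp [hd]
  obtain ⟨k, hk⟩ := h b x h0 fun c hc hcx =>
    absurd (hbx c ⟨Or.inr hc, hcx.2.le⟩) (not_le.2 hcx.1)
  have hx := hk x ⟨h0.le, le_rfl⟩
  constructor
  · intro hdx
    rw [hx]
    exact hd.2.add ((hdx.sub hd.1).zpow_mul k)
  · intro hdx
    have : (x : ℝ) = b + 2 ^ (-k) * ((f x : ℝ) - f b) := by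
      rw [hx, zpow_neg]
      field_simp
      ring
    rw [this]
    exact hd.1.add ((hdx.sub hd.2).zpow_mul _)

theorem IsThompson.one : IsThompson 1 where
  strictMono := strictMono_id
  piecewise := ⟨∅, by simp, fun x y _ _ => ⟨0, fun t _ => by simp [Homeomorph.one_apply]⟩⟩

theorem IsThompson.mul {f g : unitInterval ≃ₜ unitInterval} (hf : IsThompson f)
    (hg : IsThompson g) : IsThompson (f * g) where
  strictMono := hf.strictMono.comp hg.strictMono
  piecewise := by
    obtain ⟨B, hB, h⟩ := hf.piecewise
    obtain ⟨C, hC, h'⟩ := hg.piecewise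
    refine ⟨C ∪ B.image g.symm, ?_, ?_⟩
    · intro b hb
      have : IsDyadic b := by
        rcases Finset.mem_union.1 hb with hb | hb
        · exact (hC b hb).1
        · obtain ⟨c, hc, rfl⟩ := Finset.mem_image.1 hb
          rw [hg.dyadic_iff, g.apply_symm_apply]
          exact (hB c hc).1
      exact ⟨this, (hf.dyadic_iff _).1 ((hg.dyadic_iff _).1 this)⟩
    · intro x y hxy hm
      obtain ⟨k, hk⟩ := h' x y hxy fun b hb => hm b (Finset.mem_union_left _ hb)
      obtain ⟨l, hl⟩ := h (g x) (g y) (hg.strictMono hxy) fun b hb hbm => by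
        refine hm (g.symm b) (Finset.mem_union_right _ (Finset.mem_image_of_mem _ hb)) ⟨?_, ?_⟩
        · rw [← hg.strictMono.lt_iff_lt, g.apply_symm_apply]; exact hbm.1
        · rw [← hg.strictMono.lt_iff_lt, g.apply_symm_apply]; exact hbm.2
      refine ⟨l + k, fun t ht => ?_⟩
      have h1 := hl (g t) ⟨hg.strictMono.monotone ht.1, hg.strictMono.monotone ht.2⟩
      have h2 := hk t ht
      change ((f (g t) : unitInterval) : ℝ) = f (g x) + _
      rw [h1, h2, zpow_add₀ two_ne_zero]
      ring

theorem IsThompson.inv {f : unitInterval ≃ₜ unitInterval} (hf : IsThompson f) :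
    IsThompson f⁻¹ where
  strictMono := by
    intro x y hxy
    rw [← hf.strictMono.lt_iff_lt]
    change f (f.symm x) < f (f.symm y)
    simpa using hxy
  piecewise := by
    obtain ⟨B, hB, h⟩ := hf.piecewise
    have hlt : ∀ {x y : unitInterval}, x < y → f.symm x < f.symm y := by
      intro x y hxy
      rw [← hf.strictMono.lt_iff_lt]
      simpa using hxy
    have hle : ∀ {x y : unitInterval}, x ≤ y → f.symm x ≤ f.symm y := by
      intro x y hxy
      rw [← hf.strictMono.le_iff_le]
      simpa using hxy
    refine ⟨B.image f, ?_, ?_⟩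
    · intro b hb
      obtain ⟨c, hc, rfl⟩ := Finset.mem_image.1 hb
      refine ⟨(hB c hc).2, ?_⟩
      change IsDyadic (f.symm (f c))
      rw [f.symm_apply_apply]
      exact (hB c hc).1
    · intro x y hxy hm
      obtain ⟨k, hk⟩ := h (f.symm x) (f.symm y) (hlt hxy) fun b hb hbm => by
        refine hm (f b) (Finset.mem_image_of_mem _ hb) ⟨?_, ?_⟩
        · simpa using hf.strictMono hbm.1
        · simpa using hf.strictMono hbm.2
      refine ⟨-k, fun t ht => ?_⟩
      have h1 := hk (f.symm t) ⟨hle ht.1, hle ht.2⟩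
      change ((f.symm t : unitInterval) : ℝ) = f.symm x + _
      rw [f.apply_symm_apply, f.apply_symm_apply] at h1
      rw [h1, zpow_neg]
      field_simp
      ring

/-- Thompson's group `F`. -/
def ThompsonF : Subgroup (unitInterval ≃ₜ unitInterval) where
  carrier := {f | IsThompson f}
  mul_mem' := IsThompson.mul
  one_mem' := IsThompson.one
  inv_mem' := IsThompson.inv

/-!
Let a word of length `n` occupy the interval `[0, n]`, one unit per letter. To the edge
`[a, u = v, b]` of the Squier complex assign the dyadic piecewise linear map of the line that is the
identity up to `|a|`, maps `[|a|, |a| + |v|]` onto `[|a|, |a| + |u|]`, and is a translation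
afterwards. All these maps are conjugates, by translations, of powers of a single map
`contraction`, and the two composites around a square agree
(`contractionAt_comm`). So every loop at `w` gives a dyadic piecewise linear map supported in
`[0, |w|]`, and conjugation by a power of `contraction` moves it to `[0, 1]`: this is a homomorphism
from the diagram group to Thompson's group, whose image is `S`.

To embed its kernel in a right-angled Artin group, follow an edge path from `w` and pull back, by
the coordinate maps accumulated so far, the interval that each edge rewrites to the coordinates of
`w`. This labels the edge by a relation and a real interval. Two intervals with disjoint interiors
are declared adjacent (`intervalGraph`); edges that rewrite disjoint subwords then have commuting
labels. Labels and coordinate maps together form a functor `developFunctor` to the semidirect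
product of the Artin group with the group of increasing bijections of the line, and on the kernel
the label alone is a homomorphism.

The label is faithful (`eq_id_of_develop_left_eq_one`). A word that is trivial in a right-angled
Artin group reduces to the empty word by transpositions of commuting letters and deletions of
inverse pairs, without insertions (`reduction_nil_of_wordProd_eq_one`, proved by letting the group
act on reduced words up to shuffling). Each of these steps lifts to edge paths
(`Walk.reduction`): consecutive edges with disjoint intervals span a square, and consecutive edges
with inverse labels form a backtrack, because the interval determines the position of the subword.
-/

/-! ### The word problem in right-angled Artin groups -/

namespace RightAngledArtinGroup

variable {V : Type*} {Γ : SimpleGraph V}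

/-- The inverse of a letter; the letter `(a, true)` stands for the generator `a` and `(a, false)`
for its inverse. -/
def letterInv (x : V × Bool) : V × Bool := (x.1, !x.2)

@[simp] theorem letterInv_letterInv (x : V × Bool) : letterInv (letterInv x) = x := by
  simp [letterInv]

/-- The element of the right-angled Artin group spelled by a word. -/
def wordProd (Γ : SimpleGraph V) (l : List (V × Bool)) : RightAngledArtinGroup Γ :=
  (l.map fun x => cond x.2 (PresentedGroup.of x.1) (PresentedGroup.of x.1)⁻¹).prod

@[simp] theorem wordProd_nil : wordProd Γ [] = 1 := rfl

@[simp] theorem wordProd_cons (x : V × Bool) (l : List (V × Bool)) :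
    wordProd Γ (x :: l) =
      cond x.2 (PresentedGroup.of x.1) (PresentedGroup.of x.1)⁻¹ * wordProd Γ l := rfl

/-- Length-nonincreasing rewriting of words: transposition of neighbouring commuting letters, and
deletion of neighbouring inverse letters. Insertions are not allowed. -/
inductive Reduction (Γ : SimpleGraph V) : List (V × Bool) → List (V × Bool) → Prop
  | swap {x y : V × Bool} (l : List (V × Bool)) (h : Γ.Adj x.1 y.1) :
      Reduction Γ (x :: y :: l) (y :: x :: l)
  | cancel (x : V × Bool) (l : List (V × Bool)) : Reduction Γ (x :: letterInv x :: l) l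
  | cons (x : V × Bool) {l l' : List (V × Bool)} : Reduction Γ l l' → Reduction Γ (x :: l) (x :: l')

/-- Equality of words in the trace monoid: the equivalence relation generated by transpositions of
neighbouring commuting letters. -/
inductive Shuffle (Γ : SimpleGraph V) : List (V × Bool) → List (V × Bool) → Prop
  | nil : Shuffle Γ [] []
  | cons (x : V × Bool) {l l' : List (V × Bool)} : Shuffle Γ l l' → Shuffle Γ (x :: l) (x :: l')
  | swap {x y : V × Bool} (l : List (V × Bool)) (h : Γ.Adj x.1 y.1) :
      Shuffle Γ (x :: y :: l) (y :: x :: l)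
  | trans {l₁ l₂ l₃ : List (V × Bool)} : Shuffle Γ l₁ l₂ → Shuffle Γ l₂ l₃ → Shuffle Γ l₁ l₃

namespace Shuffle

@[refl] theorem refl (l : List (V × Bool)) : Shuffle Γ l l := by
  induction l with
  | nil => exact .nil
  | cons x l ih => exact ih.cons x

theorem symm {l l' : List (V × Bool)} (h : Shuffle Γ l l') : Shuffle Γ l' l := by
  induction h with
  | nil => exact .nil
  | cons x _ ih => exact ih.cons x
  | swap l h => exact .swap l h.symm
  | trans _ _ ih₁ ih₂ => exact ih₂.trans ih₁

theorem length_eq {l l' : List (V × Bool)} (h : Shuffle Γ l l') : l.length = l'.length := by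
  induction h with
  | nil => rfl
  | cons x _ ih => simp [ih]
  | swap l h => simp
  | trans _ _ ih₁ ih₂ => exact ih₁.trans ih₂

end Shuffle

/-- `Accessible Γ z l`: some occurrence of `z` in `l` can be shuffled to the front. -/
def Accessible (Γ : SimpleGraph V) (z : V × Bool) : List (V × Bool) → Prop
  | [] => False
  | y :: l => y = z ∨ (Γ.Adj z.1 y.1 ∧ Accessible Γ z l)

/-- A word is reduced if no letter in it can be shuffled next to a later inverse of it. -/
def Reduced (Γ : SimpleGraph V) : List (V × Bool) → Prop
  | [] => True
  | y :: l => ¬ Accessible Γ (letterInv y) l ∧ Reduced Γ l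

open Classical in
/-- Left multiplication of a word by a letter, cancelling against an accessible inverse of the
letter if there is one. -/
noncomputable def push (Γ : SimpleGraph V) (x : V × Bool) : List (V × Bool) → List (V × Bool)
  | [] => [x]
  | y :: l =>
    if y = letterInv x then l else if Γ.Adj x.1 y.1 then y :: push Γ x l else x :: y :: l

theorem push_letterInv (x : V × Bool) (l : List (V × Bool)) : push Γ x (letterInv x :: l) = l := by
  simp [push]

theorem push_of_adj {x y : V × Bool} (h : Γ.Adj x.1 y.1) (l : List (V × Bool)) :
    push Γ x (y :: l) = y :: push Γ x l := by
  have : y ≠ letterInv x := by rintro rfl; exact h.ne rfl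
  simp [push, this, h]

theorem push_of_not_adj {x y : V × Bool} (h : ¬ Γ.Adj x.1 y.1) (h' : y ≠ letterInv x)
    (l : List (V × Bool)) : push Γ x (y :: l) = x :: y :: l := by
  simp [push, h, h']

theorem Accessible.shuffle {z : V × Bool} {l l' : List (V × Bool)} (h : Shuffle Γ l l')
    (hz : Accessible Γ z l) : Accessible Γ z l' := by
  induction h with
  | nil => exact hz
  | cons x _ ih => exact hz.imp id fun h => ⟨h.1, ih h.2⟩
  | swap l h =>
    obtain rfl | ⟨h₁, rfl | ⟨h₂, h₃⟩⟩ := hz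
    · exact Or.inr ⟨h, Or.inl rfl⟩
    · exact Or.inl rfl
    · exact Or.inr ⟨h₂, Or.inr ⟨h₁, h₃⟩⟩
  | trans _ _ ih₁ ih₂ => exact ih₂ (ih₁ hz)

theorem Reduced.shuffle {l l' : List (V × Bool)} (h : Shuffle Γ l l') (hl : Reduced Γ l) :
    Reduced Γ l' := by
  induction h with
  | nil => exact hl
  | cons x h ih => exact ⟨fun ha => hl.1 (ha.shuffle h.symm), ih hl.2⟩
  | swap l h =>
    obtain ⟨h₁, h₂, h₃⟩ := hl
    refine ⟨?_, fun ha => h₁ (Or.inr ⟨h, ha⟩), h₃⟩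
    rintro (h₄ | ⟨-, h₄⟩)
    · subst h₄; exact h.ne rfl
    · exact h₂ h₄
  | trans _ _ ih₁ ih₂ => exact ih₂ (ih₁ hl)

theorem Shuffle.push (x : V × Bool) {l l' : List (V × Bool)} (h : Shuffle Γ l l') :
    Shuffle Γ (push Γ x l) (push Γ x l') := by
  induction h with
  | nil => rfl
  | @cons y l l' h ih =>
    by_cases hy : y = letterInv x
    · subst hy; simpa only [push_letterInv] using h
    by_cases ha : Γ.Adj x.1 y.1
    · simpa only [push_of_adj ha] using ih.cons y
    · simpa only [push_of_not_adj ha hy] using (h.cons y).cons x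
  | @swap y z l h =>
    by_cases hy : y = letterInv x
    · subst hy
      rw [push_letterInv, push_of_adj (x := x) h, push_letterInv]
    by_cases hz : z = letterInv x
    · subst hz
      rw [push_letterInv, push_of_adj (x := x) h.symm, push_letterInv]
    by_cases hay : Γ.Adj x.1 y.1 <;> by_cases haz : Γ.Adj x.1 z.1
    · simpa only [push_of_adj hay, push_of_adj haz] using .swap _ h
    · rw [push_of_adj hay, push_of_not_adj haz hz, push_of_not_adj haz hz]
      exact ((Shuffle.swap _ hay).symm).trans ((Shuffle.swap _ h).cons x)
    · rw [push_of_adj haz, push_of_not_adj hay hy, push_of_not_adj hay hy]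
      exact ((Shuffle.swap _ h).cons x).trans (Shuffle.swap _ haz)
    · rw [push_of_not_adj hay hy, push_of_not_adj haz hz]
      exact (Shuffle.swap _ h).cons x
  | trans _ _ ih₁ ih₂ => exact ih₁.trans ih₂

/-- Together with `shuffle_push_of_accessible`, this says that `push Γ x l` represents the product
of `x` and `l` in the Artin group. -/
theorem shuffle_push_of_not_accessible {x : V × Bool} {l : List (V × Bool)}
    (h : ¬ Accessible Γ (letterInv x) l) : Shuffle Γ (push Γ x l) (x :: l) := by
  induction l with
  | nil => rfl
  | cons y l ih =>
    by_cases ha : Γ.Adj x.1 y.1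
    · rw [push_of_adj ha]
      exact ((ih fun h' => h (Or.inr ⟨ha, h'⟩)).cons y).trans (.swap l ha.symm)
    · rw [push_of_not_adj ha fun h' => h (Or.inl h')]

theorem shuffle_push_of_accessible {x : V × Bool} {l : List (V × Bool)}
    (h : Accessible Γ (letterInv x) l) : Shuffle Γ l (letterInv x :: push Γ x l) := by
  induction l with
  | nil => exact h.elim
  | cons y l ih =>
    obtain rfl | ⟨ha, h⟩ := h
    · rw [push_letterInv]
    · rw [push_of_adj (x := x) ha]
      exact ((ih h).cons y).trans (.swap _ ha.symm)

theorem Reduced.push (x : V × Bool) {l : List (V × Bool)} (hl : Reduced Γ l) :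
    Reduced Γ (push Γ x l) := by
  by_cases h : Accessible Γ (letterInv x) l
  · exact (hl.shuffle (shuffle_push_of_accessible h)).2
  · exact Reduced.shuffle (shuffle_push_of_not_accessible h).symm ⟨h, hl⟩

/-- Reducedness is needed: pushing `letterInv x` may uncover a second cancellation otherwise. -/
theorem shuffle_push_push_letterInv (x : V × Bool) {l : List (V × Bool)} (hl : Reduced Γ l) :
    Shuffle Γ (push Γ x (push Γ (letterInv x) l)) l := by
  by_cases h : Accessible Γ (letterInv (letterInv x)) l
  · have h₁ := shuffle_push_of_accessible h
    rw [letterInv_letterInv] at h₁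
    exact (shuffle_push_of_not_accessible (hl.shuffle h₁).1).trans h₁.symm
  · simpa only [push_letterInv] using (shuffle_push_of_not_accessible h).push x

theorem shuffle_push_push_of_adj {x y : V × Bool} (h : Γ.Adj x.1 y.1) (l : List (V × Bool)) :
    Shuffle Γ (push Γ x (push Γ y l)) (push Γ y (push Γ x l)) := by
  by_cases hy : Accessible Γ (letterInv y) l
  · have h₁ := ((shuffle_push_of_accessible hy).push x).push y
    rw [push_of_adj (y := letterInv y) h, push_letterInv] at h₁
    exact h₁.symm
  · have h₁ := (shuffle_push_of_not_accessible hy).push x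
    rw [push_of_adj h] at h₁
    refine h₁.trans (shuffle_push_of_not_accessible fun h₂ => hy ?_).symm
    by_cases hx : Accessible Γ (letterInv x) l
    · exact Accessible.shuffle (shuffle_push_of_accessible hx).symm (Or.inr ⟨h.symm, h₂⟩)
    · obtain rfl | h₃ := h₂.shuffle (shuffle_push_of_not_accessible hx)
      · exact (h.ne rfl).elim
      · exact h₃.2

/-- Reduced words up to shuffling; these turn out to be normal forms for the elements of the
right-angled Artin group. -/
def reducedSetoid (Γ : SimpleGraph V) : Setoid {l : List (V × Bool) // Reduced Γ l} where
  r l l' := Shuffle Γ l.1 l'.1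
  iseqv := ⟨fun _ => .refl _, fun h => h.symm, fun h h' => h.trans h'⟩

/-- The action of a letter on reduced words up to shuffling. -/
noncomputable def pushClass (Γ : SimpleGraph V) (x : V × Bool) :
    Quotient (reducedSetoid Γ) → Quotient (reducedSetoid Γ) :=
  Quotient.map (fun l => ⟨push Γ x l.1, l.2.push x⟩) fun _ _ h => Shuffle.push x h

theorem pushClass_pushClass_letterInv (x : V × Bool) (q : Quotient (reducedSetoid Γ)) :
    pushClass Γ x (pushClass Γ (letterInv x) q) = q := by
  induction q using Quotient.inductionOn with
  | h l => exact Quotient.sound (shuffle_push_push_letterInv x l.2)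

/-- The permutation of the reduced words up to shuffling given by a generator. -/
noncomputable def pushPerm (Γ : SimpleGraph V) (a : V) :
    Equiv.Perm (Quotient (reducedSetoid Γ)) where
  toFun := pushClass Γ (a, true)
  invFun := pushClass Γ (a, false)
  left_inv := pushClass_pushClass_letterInv (a, false)
  right_inv := pushClass_pushClass_letterInv (a, true)

/-- The action of the right-angled Artin group on the reduced words up to shuffling. -/
noncomputable def pushHom (Γ : SimpleGraph V) :
    RightAngledArtinGroup Γ →* Equiv.Perm (Quotient (reducedSetoid Γ)) :=
  PresentedGroup.toGroup (f := pushPerm Γ) <| by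
    rintro _ ⟨a, b, h, rfl⟩
    simp only [map_mul, map_inv, FreeGroup.lift_apply_of]
    rw [mul_inv_eq_one, mul_inv_eq_iff_eq_mul]
    ext q
    induction q using Quotient.inductionOn with
    | h l =>
      exact Quotient.sound (shuffle_push_push_of_adj (x := (a, true)) (y := (b, true)) h l.1)

/-- The action of the group element spelled by a word takes the empty word to the normal form of the
word. -/
theorem pushHom_wordProd (l : List (V × Bool)) :
    ∃ h : Reduced Γ (l.foldr (push Γ) []), pushHom Γ (wordProd Γ l) ⟦⟨[], trivial⟩⟧ =
      ⟦⟨l.foldr (push Γ) [], h⟩⟧ := by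
  induction l with
  | nil => exact ⟨trivial, by simp⟩
  | cons x l ih =>
    obtain ⟨h, ih⟩ := ih
    refine ⟨h.push x, ?_⟩
    rw [wordProd_cons, map_mul, Equiv.Perm.mul_apply, ih]
    obtain ⟨a, _ | _⟩ := x
    · simp only [cond_false, map_inv, pushHom, PresentedGroup.toGroup.of]
      rfl
    · simp only [cond_true, pushHom, PresentedGroup.toGroup.of]
      rfl

open Relation in
theorem reduction_push (x : V × Bool) (l : List (V × Bool)) :
    ReflTransGen (Reduction Γ) (x :: l) (push Γ x l) := by
  induction l with
  | nil => rfl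
  | cons y l ih =>
    by_cases hy : y = letterInv x
    · subst hy
      rw [push_letterInv]
      exact .single (.cancel x l)
    by_cases ha : Γ.Adj x.1 y.1
    · rw [push_of_adj ha]
      exact .head (.swap l ha) (ih.lift _ fun _ _ h => h.cons y)
    · rw [push_of_not_adj ha hy]

open Relation in
/-- A word that is trivial in the right-angled Artin group can be reduced to the empty word by
commutations and cancellations alone. -/
theorem reduction_nil_of_wordProd_eq_one {l : List (V × Bool)} (h : wordProd Γ l = 1) :
    ReflTransGen (Reduction Γ) l [] := by
  have h₁ : l.foldr (push Γ) [] = [] := by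
    obtain ⟨h₁, h₂⟩ := pushHom_wordProd (Γ := Γ) l
    rw [h, map_one, Equiv.Perm.one_apply] at h₂
    exact List.length_eq_zero_iff.1 (Shuffle.length_eq (Quotient.exact h₂)).symm
  have h₂ : ∀ l : List (V × Bool), ReflTransGen (Reduction Γ) l (l.foldr (push Γ) []) := by
    intro l
    induction l with
    | nil => rfl
    | cons x l ih => exact (ih.lift _ fun _ _ h => h.cons x).trans (reduction_push x _)
  simpa only [h₁] using h₂ l

/-- The homomorphism of right-angled Artin groups induced by a graph homomorphism. -/
def map {W : Type*} {Δ : SimpleGraph W} (f : Γ →g Δ) :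
    RightAngledArtinGroup Γ →* RightAngledArtinGroup Δ :=
  PresentedGroup.toGroup (f := fun a => PresentedGroup.of (f a)) <| by
    rintro _ ⟨a, b, h, rfl⟩
    simp only [map_mul, map_inv, FreeGroup.lift_apply_of]
    exact PresentedGroup.one_of_mem ⟨f a, f b, f.map_adj h, rfl⟩

@[simp] theorem map_of {W : Type*} {Δ : SimpleGraph W} (f : Γ →g Δ) (a : V) :
    map f (PresentedGroup.of a) = PresentedGroup.of (f a) := by
  simp [map]

theorem of_mul_of_comm {a b : V} (h : Γ.Adj a b) :
    (PresentedGroup.of a * PresentedGroup.of b : RightAngledArtinGroup Γ) =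
      PresentedGroup.of b * PresentedGroup.of a := by
  rw [← mul_inv_eq_iff_eq_mul, ← mul_inv_eq_one]
  exact PresentedGroup.one_of_mem ⟨a, b, h, rfl⟩

end RightAngledArtinGroup

/-! ### Dyadic piecewise linear maps of the real line -/

/-- An increasing bijection of the real line is a dyadic piecewise linear map if it preserves
the dyadic rationals in both directions and there is a finite set of dyadic points such that it is
affine with slope a power of `2` on every interval whose interior avoids this set. -/
structure IsDyadicPL (f : ℝ ≃o ℝ) : Prop where
  dyadic_iff : ∀ t, IsDyadic (f t) ↔ IsDyadic t
  piecewise : ∃ B : Finset ℝ, (∀ b ∈ B, IsDyadic b) ∧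
    ∀ x y : ℝ, x < y → (∀ b ∈ B, b ∉ Set.Ioo x y) →
      ∃ k : ℤ, ∀ t ∈ Set.Icc x y, f t = f x + 2 ^ k * (t - x)

theorem IsDyadic.natCast (n : ℕ) : IsDyadic n := ⟨n, 0, by simp⟩

theorem IsDyadic.half {t : ℝ} (h : IsDyadic t) : IsDyadic (t / 2) := by
  have := h.zpow_mul (-1)
  rwa [zpow_neg_one, inv_mul_eq_div] at this

/-- The group of dyadic piecewise linear maps of the real line. -/
def dyadicPL : Subgroup (ℝ ≃o ℝ) where
  carrier := {f | IsDyadicPL f}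
  one_mem' := ⟨fun _ => Iff.rfl, ∅, by simp, fun x y _ _ => ⟨0, fun t _ => by simp⟩⟩
  mul_mem' := by
    rintro f g ⟨hf, B, hB, h⟩ ⟨hg, C, hC, h'⟩
    refine ⟨fun t => (hf _).trans (hg t), C ∪ B.image g.symm, ?_, ?_⟩
    · intro b hb
      rcases Finset.mem_union.1 hb with hb | hb
      · exact hC b hb
      · obtain ⟨c, hc, rfl⟩ := Finset.mem_image.1 hb
        rw [← hg, g.apply_symm_apply]
        exact hB c hc
    · intro x y hxy hm
      obtain ⟨k, hk⟩ := h' x y hxy fun b hb => hm b (Finset.mem_union_left _ hb)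
      obtain ⟨l, hl⟩ := h (g x) (g y) (g.strictMono hxy) fun b hb hbm =>
        hm (g.symm b) (Finset.mem_union_right _ (Finset.mem_image_of_mem _ hb))
          ⟨by simpa [OrderIso.lt_symm_apply] using hbm.1,
            by simpa [OrderIso.symm_apply_lt] using hbm.2⟩
      refine ⟨l + k, fun t ht => ?_⟩
      have h1 := hl (g t) ⟨g.monotone ht.1, g.monotone ht.2⟩
      have h2 := hk t ht
      change f (g t) = f (g x) + _
      rw [h1, h2, zpow_add₀ two_ne_zero]
      ring
  inv_mem' := by
    rintro f ⟨hf, B, hB, h⟩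
    refine ⟨fun t => ?_, B.image f, ?_, ?_⟩
    · change IsDyadic (f.symm t) ↔ _
      rw [← hf, f.apply_symm_apply]
    · intro b hb
      obtain ⟨c, hc, rfl⟩ := Finset.mem_image.1 hb
      exact (hf c).2 (hB c hc)
    · intro x y hxy hm
      obtain ⟨k, hk⟩ := h (f.symm x) (f.symm y) (f.symm.strictMono hxy) fun b hb hbm =>
        hm (f b) (Finset.mem_image_of_mem _ hb)
          ⟨by simpa [OrderIso.symm_apply_lt] using hbm.1,
            by simpa [OrderIso.lt_symm_apply] using hbm.2⟩
      refine ⟨-k, fun t ht => ?_⟩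
      have h1 := hk (f.symm t) ⟨f.symm.monotone ht.1, f.symm.monotone ht.2⟩
      change f.symm t = f.symm x + _
      rw [f.apply_symm_apply, f.apply_symm_apply] at h1
      generalize f.symm t = s, f.symm x = s₀ at h1 ⊢
      rw [h1, zpow_neg]
      field_simp
      ring

/-- The map that halves `[0, 2]`, is the identity to the left of `0`, and translates by `-1` to the
right of `2`. -/
noncomputable def contraction : ℝ ≃o ℝ where
  toFun t := min t (max (t / 2) (t - 1))
  invFun t := max t (min (2 * t) (t + 1))
  left_inv t := by
    dsimp only
    rcases min_cases t (max (t / 2) (t - 1)) with ⟨h, _⟩ | ⟨h, _⟩ <;>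
    rcases max_cases (t / 2) (t - 1) with ⟨h', _⟩ | ⟨h', _⟩ <;> simp only [h'] at * <;>
    grind
  right_inv t := by
    dsimp only
    rcases max_cases t (min (2 * t) (t + 1)) with ⟨h, _⟩ | ⟨h, _⟩ <;>
    rcases min_cases (2 * t) (t + 1) with ⟨h', _⟩ | ⟨h', _⟩ <;> simp only [h'] at * <;>
    grind
  map_rel_iff' := by
    intro s t
    change min s (max (s / 2) (s - 1)) ≤ min t (max (t / 2) (t - 1)) ↔ s ≤ t
    grind

theorem contraction_apply (t : ℝ) : contraction t = min t (max (t / 2) (t - 1)) := rfl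

theorem contraction_of_nonpos {t : ℝ} (h : t ≤ 0) : contraction t = t := by
  rw [contraction_apply]; grind

theorem contraction_of_mem_Icc {t : ℝ} (h : 0 ≤ t) (h' : t ≤ 2) : contraction t = t / 2 := by
  rw [contraction_apply]; grind

theorem contraction_of_two_le {t : ℝ} (h : 2 ≤ t) : contraction t = t - 1 := by
  rw [contraction_apply]; grind

theorem contraction_mem_dyadicPL : contraction ∈ dyadicPL := by
  refine ⟨fun t => ?_, {0, 2}, ?_, ?_⟩
  · have h₁ : IsDyadic 1 := by simpa using IsDyadic.natCast 1
    rcases le_total t 0 with h | h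
    · rw [contraction_of_nonpos h]
    rcases le_total t 2 with h' | h'
    · rw [contraction_of_mem_Icc h h']
      refine ⟨fun h => ?_, fun h => h.half⟩
      simpa [mul_div_cancel₀] using h.zpow_mul 1
    · rw [contraction_of_two_le h']
      exact ⟨fun h => by simpa using h.add h₁, fun h => h.sub h₁⟩
  · intro b hb
    rcases Finset.mem_insert.1 hb with rfl | hb
    · simpa using IsDyadic.natCast 0
    · rw [Finset.mem_singleton.1 hb]
      simpa using IsDyadic.natCast 2
  · intro x y hxy hm
    have h₀ : y ≤ 0 ∨ 0 ≤ x := by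
      have := hm 0 (by simp)
      grind
    have h₂ : y ≤ 2 ∨ 2 ≤ x := by
      have := hm 2 (by simp)
      grind
    rcases h₀ with h₀ | h₀
    · refine ⟨0, fun t ht => ?_⟩
      rw [contraction_of_nonpos (ht.2.trans h₀), contraction_of_nonpos (hxy.le.trans h₀)]
      simp
    rcases h₂ with h₂ | h₂
    · refine ⟨-1, fun t ht => ?_⟩
      rw [contraction_of_mem_Icc (h₀.trans ht.1) (ht.2.trans h₂),
        contraction_of_mem_Icc h₀ (hxy.le.trans h₂), zpow_neg_one]
      ring
    · refine ⟨0, fun t ht => ?_⟩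
      rw [contraction_of_two_le (h₂.trans ht.1), contraction_of_two_le h₂]
      simp

theorem addRight_natCast_mem_dyadicPL (n : ℕ) : OrderIso.addRight (n : ℝ) ∈ dyadicPL := by
  refine ⟨fun t => ⟨fun h => by simpa using h.sub (.natCast n), fun h => h.add (.natCast n)⟩,
    ∅, by simp, fun x y _ _ => ⟨0, fun t _ => by simp; ring⟩⟩

theorem contraction_pow_of_nonpos (k : ℕ) {t : ℝ} (h : t ≤ 0) : (contraction ^ k) t = t := by
  induction k with
  | zero => simp
  | succ k ih => rw [pow_succ', RelIso.mul_apply, ih, contraction_of_nonpos h]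

theorem contraction_pow_of_le (k : ℕ) {t : ℝ} (h : k + 1 ≤ t) : (contraction ^ k) t = t - k := by
  induction k with
  | zero => simp
  | succ k ih =>
    push_cast at h ⊢
    rw [pow_succ', RelIso.mul_apply, ih (by linarith), contraction_of_two_le (by linarith)]
    ring

theorem contraction_zpow_of_nonpos (k : ℤ) {t : ℝ} (h : t ≤ 0) : (contraction ^ k) t = t := by
  obtain ⟨k, rfl | rfl⟩ := k.eq_nat_or_neg
  · rw [zpow_natCast, contraction_pow_of_nonpos k h]
  · rw [zpow_neg, zpow_natCast]
    nth_rw 1 [← contraction_pow_of_nonpos k h]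
    exact RelIso.inv_apply_self _ _

/-- The `(n - m)`-th power of the contraction maps `[0, n]` to `[0, m]` and is a translation to the
right of `n`. -/
theorem contraction_zpow_of_le {m n : ℕ} (hm : 0 < m) (hn : 0 < n) {t : ℝ} (h : n ≤ t) :
    (contraction ^ ((n : ℤ) - m)) t = t + m - n := by
  rcases le_total m n with hmn | hmn
  · obtain ⟨k, rfl⟩ := Nat.exists_eq_add_of_le hmn
    have hm' : (1 : ℝ) ≤ m := by exact_mod_cast hm
    push_cast at h ⊢
    rw [add_sub_cancel_left, zpow_natCast, contraction_pow_of_le k (by linarith)]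
    ring
  · obtain ⟨k, rfl⟩ := Nat.exists_eq_add_of_le hmn
    have hn' : (1 : ℝ) ≤ n := by exact_mod_cast hn
    push_cast at h ⊢
    have h₁ : (contraction ^ k) (t + k) = t := by
      rw [contraction_pow_of_le k (by linarith)]
      ring
    rw [sub_add_cancel_left, zpow_neg, zpow_natCast]
    nth_rw 1 [← h₁]
    rw [RelIso.inv_apply_self]
    ring

/-- The `k`-th power of `contraction`, conjugated by the translation that moves `0` to `a`. -/
noncomputable def contractionAt (a : ℕ) (k : ℤ) : ℝ ≃o ℝ :=
  OrderIso.addRight (a : ℝ) * contraction ^ k * (OrderIso.addRight (a : ℝ))⁻¹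

theorem contractionAt_apply (a : ℕ) (k : ℤ) (t : ℝ) :
    contractionAt a k t = (contraction ^ k) (t - a) + a := rfl

theorem contractionAt_mem_dyadicPL (a : ℕ) (k : ℤ) : contractionAt a k ∈ dyadicPL :=
  mul_mem (mul_mem (addRight_natCast_mem_dyadicPL a) (zpow_mem contraction_mem_dyadicPL k))
    (inv_mem (addRight_natCast_mem_dyadicPL a))

theorem contractionAt_inv (a : ℕ) (k : ℤ) : (contractionAt a k)⁻¹ = contractionAt a (-k) := by
  simp [contractionAt, mul_assoc]

theorem contractionAt_of_le {a : ℕ} (k : ℤ) {t : ℝ} (h : t ≤ a) : contractionAt a k t = t := by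
  rw [contractionAt_apply, contraction_zpow_of_nonpos k (by linarith)]
  ring

theorem contractionAt_of_ge (a : ℕ) {m n : ℕ} (hm : 0 < m) (hn : 0 < n) {t : ℝ}
    (h : a + n ≤ t) : contractionAt a ((n : ℤ) - m) t = t + m - n := by
  rw [contractionAt_apply, contraction_zpow_of_le hm hn (by linarith)]
  ring

/-- Changes of coordinates in disjoint places commute, up to the displacement of the right-hand one
by the left-hand one. -/
theorem contractionAt_comm (a b : ℕ) {m n : ℕ} (hm : 0 < m) (hn : 0 < n) (l : ℤ) :
    contractionAt a ((n : ℤ) - m) * contractionAt (a + n + b) l =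
      contractionAt (a + m + b) l * contractionAt a ((n : ℤ) - m) := by
  ext t
  rw [RelIso.mul_apply, RelIso.mul_apply]
  have hb : (0 : ℝ) ≤ b := by positivity
  have h₀ : contractionAt a ((n : ℤ) - m) (a + n + b : ℕ) = (a + m + b : ℕ) := by
    rw [contractionAt_of_ge a hm hn (by push_cast; linarith)]
    push_cast
    ring
  rcases le_total t (a + n + b : ℕ) with h | h
  · rw [contractionAt_of_le l h, contractionAt_of_le l]
    rw [← h₀]
    exact (contractionAt _ _).monotone h
  · have h₁ : ((a + n + b : ℕ) : ℝ) ≤ contractionAt (a + n + b) l t := by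
      nth_rw 1 [← contractionAt_of_le l (le_refl ((a + n + b : ℕ) : ℝ))]
      exact (contractionAt _ _).monotone h
    push_cast at h h₁
    rw [contractionAt_of_ge a hm hn (by linarith),
      contractionAt_of_ge a hm hn (by linarith), contractionAt_apply, contractionAt_apply]
    push_cast
    rw [show t + m - n - (a + m + b : ℝ) = t - (a + n + b) by ring]
    ring

/-! ### Restriction to the unit interval -/

/-- The group of dyadic piecewise linear maps of the real line supported in `[0, 1]`. -/
def dyadicPLUnit : Subgroup (ℝ ≃o ℝ) where
  carrier := {f | f ∈ dyadicPL ∧ (∀ t ≤ 0, f t = t) ∧ ∀ t, 1 ≤ t → f t = t}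
  one_mem' := ⟨one_mem _, fun _ _ => rfl, fun _ _ => rfl⟩
  mul_mem' := by
    rintro f g ⟨hf, hf₀, hf₁⟩ ⟨hg, hg₀, hg₁⟩
    refine ⟨mul_mem hf hg, fun t ht => ?_, fun t ht => ?_⟩
    · rw [RelIso.mul_apply, hg₀ t ht, hf₀ t ht]
    · rw [RelIso.mul_apply, hg₁ t ht, hf₁ t ht]
  inv_mem' := by
    rintro f ⟨hf, hf₀, hf₁⟩
    refine ⟨inv_mem hf, fun t ht => ?_, fun t ht => ?_⟩
    · nth_rw 1 [← hf₀ t ht]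
      exact RelIso.inv_apply_self _ _
    · nth_rw 1 [← hf₁ t ht]
      exact RelIso.inv_apply_self _ _

namespace dyadicPLUnit

theorem apply_mem (f : dyadicPLUnit) (t : unitInterval) : f.1 t ∈ unitInterval :=
  ⟨by
    have h := f.1.monotone t.2.1
    rwa [f.2.2.1 0 le_rfl] at h, by
    have h := f.1.monotone t.2.2
    rwa [f.2.2.2 1 le_rfl] at h⟩

/-- The order automorphism of the unit interval given by a map supported there. -/
def restrict (f : dyadicPLUnit) : unitInterval ≃o unitInterval where
  toFun t := ⟨f.1 t, apply_mem f t⟩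
  invFun t := ⟨f⁻¹.1 t, apply_mem f⁻¹ t⟩
  left_inv t := Subtype.ext (RelIso.inv_apply_self f.1 t.1)
  right_inv t := Subtype.ext (RelIso.apply_inv_self f.1 t.1)
  map_rel_iff' {s t} := f.1.map_rel_iff' (a := s.1) (b := t.1)

theorem isThompson_restrict (f : dyadicPLUnit) : IsThompson (restrict f).toHomeomorph where
  strictMono := (restrict f).strictMono
  piecewise := by
    obtain ⟨B, hB, h⟩ := f.2.1.piecewise
    refine ⟨B.subtype (· ∈ unitInterval), fun b hb => ?_, fun x y hxy hm => ?_⟩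
    · have hb' := hB b (Finset.mem_subtype.1 hb)
      exact ⟨hb', (f.2.1.dyadic_iff _).2 hb'⟩
    · obtain ⟨k, hk⟩ := h x y hxy fun b hb hbm =>
        hm ⟨b, x.2.1.trans hbm.1.le, hbm.2.le.trans y.2.2⟩ (Finset.mem_subtype.2 hb) hbm
      exact ⟨k, fun t ht => hk t ht⟩

/-- Dyadic piecewise linear maps of the real line supported in `[0, 1]` as elements of Thompson's
group. -/
def toThompsonF : dyadicPLUnit →* ThompsonF where
  toFun f := ⟨(restrict f).toHomeomorph, isThompson_restrict f⟩
  map_one' := rfl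
  map_mul' _ _ := rfl

theorem toThompsonF_injective : Function.Injective toThompsonF := by
  refine (injective_iff_map_eq_one _).2 fun f hf => Subtype.ext (RelIso.ext fun t => ?_)
  change f.1 t = t
  rcases le_total t 0 with h | h
  · exact f.2.2.1 t h
  rcases le_total 1 t with h' | h'
  · exact f.2.2.2 t h'
  have h₁ := DFunLike.congr_fun (congrArg Subtype.val hf) (⟨t, h, h'⟩ : unitInterval)
  exact congrArg Subtype.val h₁

end dyadicPLUnit

/-! ### The interval graph and the action of the line on its Artin group -/

/-- The graph of nondegenerate real intervals coloured by `ι`: two intervals `[p, q]` are adjacent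
if their interiors are disjoint. -/
def intervalGraph (ι : Type*) : SimpleGraph (ι × ℝ × ℝ) where
  Adj x y := x.2.1 < x.2.2 ∧ y.2.1 < y.2.2 ∧ (x.2.2 ≤ y.2.1 ∨ y.2.2 ≤ x.2.1)
  symm := ⟨fun _ _ h => ⟨h.2.1, h.1, h.2.2.symm⟩⟩
  loopless := ⟨fun _ h => by
    rcases h with ⟨h₁, -, h₂ | h₂⟩ <;> exact absurd h₁ (not_lt.2 h₂)⟩

namespace intervalGraph

open RightAngledArtinGroup

/-- The graph endomorphism induced by an increasing bijection of the line. -/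
def mapHom (ι : Type*) (f : ℝ ≃o ℝ) : intervalGraph ι →g intervalGraph ι where
  toFun x := (x.1, f x.2.1, f x.2.2)
  map_rel' h := by simpa [intervalGraph] using h

/-- The action of the increasing bijections of the line on the right-angled Artin group of the
interval graph. -/
def aut (ι : Type*) : (ℝ ≃o ℝ) →* MulAut (RightAngledArtinGroup (intervalGraph ι)) where
  toFun f := MonoidHom.toMulEquiv (map (mapHom ι f)) (map (mapHom ι f⁻¹))
    (PresentedGroup.ext fun x => by
      simp [mapHom])
    (PresentedGroup.ext fun x => by
      simp [mapHom])
  map_one' := MulEquiv.toMonoidHom_injective <| PresentedGroup.ext fun _ => map_of _ _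
  map_mul' f g := MulEquiv.toMonoidHom_injective <| PresentedGroup.ext fun x =>
    (map_of _ _).trans <| Eq.symm <| (congrArg _ (map_of (mapHom ι g) x)).trans (map_of _ _)

@[simp] theorem aut_of {ι : Type*} (f : ℝ ≃o ℝ) (r : ι) (p q : ℝ) :
    aut ι f (PresentedGroup.of (r, p, q)) = PresentedGroup.of (r, f p, f q) :=
  map_of (mapHom ι f) _

end intervalGraph

/-! ### Directed edges and squares of the Squier complex -/

namespace SemigroupPresentation

open CategoryTheory

variable {α : Type*} (P : SemigroupPresentation α)

/-- A side of a relation: the left-hand side for `true`, the right-hand side for `false`. -/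
def side (r : P.rels) (b : Bool) : List α := cond b r.1.1 r.1.2

theorem side_length_pos (r : P.rels) (b : Bool) : 0 < (P.side r b).length := by
  cases b
  · exact List.length_pos_iff.2 (P.rhs_ne_nil r.1 r.2)
  · exact List.length_pos_iff.2 (P.lhs_ne_nil r.1 r.2)

/-- An edge of the Squier complex with a direction, positive for `true` and negative for
`false`. -/
structure Move (x y : List α) where
  pre : List α
  rel : P.rels
  sign : Bool
  suf : List α
  source_eq : x = pre ++ P.side rel sign ++ suf
  target_eq : y = pre ++ P.side rel (!sign) ++ suf

variable {P}

/-- The class of an edge in the fundamental groupoid of the Squier complex. -/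
def edgeHom {x y : List α} (e : P.Edge x y) : P.basepoint x ⟶ P.basepoint y :=
  (CategoryTheory.Quotient.functor P.SquareRel).map (P.edgeClass e)

namespace Move

/-- The class of a directed edge in the fundamental groupoid of the Squier complex. -/
def hom : {x y : List α} → P.Move x y → (P.basepoint x ⟶ P.basepoint y)
  | _, _, ⟨a, r, true, c, h, h'⟩ => edgeHom ⟨a, r, c, h, h'⟩
  | _, _, ⟨a, r, false, c, h, h'⟩ => Groupoid.inv (edgeHom ⟨a, r, c, h', h⟩)

/-- The directed edge traversed backwards. -/
def reverse {x y : List α} (m : P.Move x y) : P.Move y x where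
  pre := m.pre
  rel := m.rel
  sign := !m.sign
  suf := m.suf
  source_eq := m.target_eq
  target_eq := by rw [Bool.not_not]; exact m.source_eq

theorem hom_reverse {x y : List α} (m : P.Move x y) : m.reverse.hom = Groupoid.inv m.hom := by
  obtain ⟨a, r, _ | _, c, h, h'⟩ := m
  · simp only [reverse, hom, Groupoid.inv_eq_inv, IsIso.inv_inv]
    rfl
  · rfl

end Move

/-- The square relation for edges, with the two edge paths from corner to opposite corner. -/
theorem edgeHom_square {a b c : List α} {r s : P.rels} {x y y' z : List α}
    (h₁ : x = a ++ r.1.1 ++ (b ++ s.1.1 ++ c)) (h₁' : y = a ++ r.1.2 ++ (b ++ s.1.1 ++ c))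
    (h₂ : y = (a ++ r.1.2 ++ b) ++ s.1.1 ++ c) (h₂' : z = (a ++ r.1.2 ++ b) ++ s.1.2 ++ c)
    (h₃ : x = (a ++ r.1.1 ++ b) ++ s.1.1 ++ c) (h₃' : y' = (a ++ r.1.1 ++ b) ++ s.1.2 ++ c)
    (h₄ : y' = a ++ r.1.1 ++ (b ++ s.1.2 ++ c)) (h₄' : z = a ++ r.1.2 ++ (b ++ s.1.2 ++ c)) :
    edgeHom (P := P) ⟨a, r, _, h₁, h₁'⟩ ≫ edgeHom ⟨_, s, c, h₂, h₂'⟩ =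
      edgeHom ⟨_, s, c, h₃, h₃'⟩ ≫ edgeHom ⟨a, r, _, h₄, h₄'⟩ := by
  refine ((CategoryTheory.Functor.map_comp _ _ _).symm.trans ?_).trans
    (CategoryTheory.Functor.map_comp _ _ _)
  exact CategoryTheory.Quotient.sound _ (.square a r b s c _ _ _ _ ⟨rfl, rfl, rfl⟩ ⟨rfl, rfl, rfl⟩
    ⟨rfl, rfl, rfl⟩ ⟨rfl, rfl, rfl⟩)

theorem inv_square {C : Type*} [Groupoid C] {x y y' z : C} {e₁ : x ⟶ y} {f₂ : y ⟶ z} {f₁ : x ⟶ y'}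
    {e₂ : y' ⟶ z} (h : e₁ ≫ f₂ = f₁ ≫ e₂) :
    Groupoid.inv e₁ ≫ f₁ = f₂ ≫ Groupoid.inv e₂ ∧ e₂ ≫ Groupoid.inv f₂ = Groupoid.inv f₁ ≫ e₁ ∧
      Groupoid.inv e₂ ≫ Groupoid.inv f₁ = Groupoid.inv f₂ ≫ Groupoid.inv e₁ := by
  simp only [Groupoid.inv_eq_inv]
  refine ⟨?_, ?_, ?_⟩
  · rw [IsIso.inv_comp_eq, ← Category.assoc, h, Category.assoc, IsIso.hom_inv_id, Category.comp_id]
  · rw [IsIso.eq_inv_comp, ← Category.assoc, ← h, Category.assoc, IsIso.hom_inv_id,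
      Category.comp_id]
  · simp only [← IsIso.inv_comp, h]

/-- Two moves in disjoint places, the first one on the left, may be exchanged. -/
theorem Move.exists_square {x y z : List α} (m₁ : P.Move x y) (m₂ : P.Move y z) (b : List α)
    (h : m₂.pre = m₁.pre ++ P.side m₁.rel (!m₁.sign) ++ b) :
    ∃ (y' : List α) (m₂' : P.Move x y') (m₁' : P.Move y' z),
      m₁.hom ≫ m₂.hom = m₂'.hom ≫ m₁'.hom ∧
      m₂'.pre = m₁.pre ++ P.side m₁.rel m₁.sign ++ b ∧ m₂'.rel = m₂.rel ∧ m₂'.sign = m₂.sign ∧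
      m₁'.pre = m₁.pre ∧ m₁'.rel = m₁.rel ∧ m₁'.sign = m₁.sign := by
  obtain ⟨a, r, ε, c', h₁, h₁'⟩ := m₁
  obtain ⟨_, s, δ, c, h₂, h₂'⟩ := m₂
  dsimp only at h
  subst h
  obtain rfl : c' = b ++ P.side s δ ++ c := by
    simpa [h₁'] using h₂
  refine ⟨(a ++ P.side r ε ++ b) ++ P.side s (!δ) ++ c,
    ⟨a ++ P.side r ε ++ b, s, δ, c, by simp [h₁], rfl⟩,
    ⟨a, r, ε, b ++ P.side s (!δ) ++ c, by simp, by simp [h₂']⟩, ?_, rfl, rfl, rfl, rfl, rfl, rfl⟩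
  cases ε <;> cases δ
  · exact (inv_square (edgeHom_square ..)).2.2
  · exact (inv_square (edgeHom_square ..)).1
  · exact (inv_square (edgeHom_square ..)).2.1
  · exact edgeHom_square ..

/-- Two moves in disjoint places, the first one on the right, may be exchanged. -/
theorem Move.exists_square' {x y z : List α} (m₁ : P.Move x y) (m₂ : P.Move y z) (b : List α)
    (h : m₁.pre = m₂.pre ++ P.side m₂.rel m₂.sign ++ b) :
    ∃ (y' : List α) (m₂' : P.Move x y') (m₁' : P.Move y' z),
      m₁.hom ≫ m₂.hom = m₂'.hom ≫ m₁'.hom ∧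
      m₁'.pre = m₂.pre ++ P.side m₂.rel (!m₂.sign) ++ b ∧ m₁'.rel = m₁.rel ∧ m₁'.sign = m₁.sign ∧
      m₂'.pre = m₂.pre ∧ m₂'.rel = m₂.rel ∧ m₂'.sign = m₂.sign := by
  obtain ⟨y', n₁, n₂, hn, h₁, h₂, h₃, h₄, h₅, h₆⟩ := m₂.reverse.exists_square m₁.reverse b
    (by simpa [reverse] using h)
  refine ⟨y', n₂.reverse, n₁.reverse, ?_, h₁, h₂, by simp [reverse, h₃], h₄, h₅,
    by simp [reverse, h₆]⟩
  simp only [hom_reverse, Groupoid.inv_eq_inv] at hn ⊢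
  rw [← IsIso.inv_comp]
  simp only [← hn, IsIso.inv_comp, IsIso.inv_inv]

/-- The class of an edge path in the fundamental groupoid of the Squier complex. -/
def pathHom {x y : List α} (p : Quiver.Path (V := Quiver.Symmetrify P.Vertex) x y) :
    P.basepoint x ⟶ P.basepoint y :=
  Quot.mk _ (Quot.mk _ p)

/-- Elements of the fundamental groupoid are composites of directed edges. -/
theorem hom_induction {motive : ∀ {x y : List α}, (P.basepoint x ⟶ P.basepoint y) → Prop}
    (id : ∀ x, motive (𝟙 (P.basepoint x)))
    (comp : ∀ {x y z : List α} (m : P.Move x y) (g : P.basepoint y ⟶ P.basepoint z), motive g →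
      motive (m.hom ≫ g)) {x y : List α} (g : P.basepoint x ⟶ P.basepoint y) : motive g := by
  have key : ∀ {x y : List α} (p : Quiver.Path (V := Quiver.Symmetrify P.Vertex) x y),
      ∀ {z : List α} (g : P.basepoint y ⟶ P.basepoint z), motive g → motive (pathHom p ≫ g) := by
    intro x y p
    induction p with
    | nil => exact fun g hg => cast (congrArg motive (Category.id_comp g).symm) hg
    | cons p e ih =>
      intro z g hg
      rcases e with e | e
      · exact cast (congrArg motive (Category.assoc _ _ _).symm)
          (ih _ (comp ⟨e.pre, e.rel, true, e.suf, e.source_eq, e.target_eq⟩ g hg))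
      · exact cast (congrArg motive (Category.assoc _ _ _).symm)
          (ih _ (comp ⟨e.pre, e.rel, false, e.suf, e.target_eq, e.source_eq⟩ g hg))
  obtain ⟨⟨p⟩⟩ := g
  exact cast (congrArg motive (Category.comp_id (pathHom p))) (key p (𝟙 _) (id y))

/-! ### The development of the Squier complex -/

variable (P) in
/-- The semidirect product of the right-angled Artin group of the graph of intervals coloured by
relations with the group of increasing bijections of the line, in which the Squier complex is
developed. -/
abbrev Development :=
  SemidirectProduct (RightAngledArtinGroup (intervalGraph P.rels)) (ℝ ≃o ℝ)
    (intervalGraph.aut P.rels)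

/-- The value of an edge in the development. Its first component is the generator given by the
place of the edge; its second component maps the coordinates of the target word to those of the
source word, where the `i`-th letter of a word occupies the interval `[i, i + 1]`. -/
noncomputable def edgeValue {x y : List α} (e : P.Edge x y) : P.Development :=
  ⟨PresentedGroup.of (e.rel, e.pre.length, e.pre.length + e.rel.1.1.length),
    contractionAt e.pre.length ((e.rel.1.2.length : ℤ) - e.rel.1.1.length)⟩

variable (P) in
/-- The values of the edges, as a functor on the fundamental groupoid of the one-skeleton. As
composition in a one-object category is reversed multiplication, the target is the opposite
group. -/
noncomputable def skeletonFunctor : P.SkeletonGroupoid ⥤ SingleObj P.Developmentᵐᵒᵖ :=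
  Quiver.FreeGroupoid.lift
    { obj := fun _ => SingleObj.star _
      map := fun e => MulOpposite.op (edgeValue e) }

theorem skeletonFunctor_edgeClass {x y : List α} (e : P.Edge x y) :
    P.skeletonFunctor.map (P.edgeClass e) = MulOpposite.op (edgeValue e) :=
  Category.id_comp _

/-- The two edge paths around a square have the same value. The relation words are nonempty, so the
intervals of the two edges are nondegenerate and their generators are adjacent. -/
theorem edgeValue_square {a b c : List α} {r s : P.rels} {x y y' z : List α} {e₁ : P.Edge x y}
    {e₂ : P.Edge y z} {e₁' : P.Edge x y'} {e₂' : P.Edge y' z}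
    (h₁ : e₁.pre = a ∧ e₁.rel = r ∧ e₁.suf = b ++ s.1.1 ++ c)
    (h₂ : e₂.pre = a ++ r.1.2 ++ b ∧ e₂.rel = s ∧ e₂.suf = c)
    (h₁' : e₁'.pre = a ++ r.1.1 ++ b ∧ e₁'.rel = s ∧ e₁'.suf = c)
    (h₂' : e₂'.pre = a ∧ e₂'.rel = r ∧ e₂'.suf = b ++ s.1.2 ++ c) :
    edgeValue e₁ * edgeValue e₂ = edgeValue e₁' * edgeValue e₂' := by
  have hr₁ : 0 < r.1.1.length := P.side_length_pos r true
  have hr₂ : 0 < r.1.2.length := P.side_length_pos r false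
  have hs₁ : 0 < s.1.1.length := P.side_length_pos s true
  have hr₁' : (0 : ℝ) < r.1.1.length := by exact_mod_cast hr₁
  have hs₁' : (0 : ℝ) < s.1.1.length := by exact_mod_cast hs₁
  have hb : (0 : ℝ) ≤ b.length := by positivity
  refine SemidirectProduct.ext ?_ ?_
  · simp only [SemidirectProduct.mul_left, edgeValue, intervalGraph.aut_of, h₁, h₂, h₁', h₂',
      List.length_append, Nat.cast_add]
    rw [contractionAt_of_ge _ hr₁ hr₂ (by linarith), contractionAt_of_ge _ hr₁ hr₂ (by linarith),
      contractionAt_of_le _ (by push_cast; linarith),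
      contractionAt_of_le _ (by push_cast; linarith),
      RightAngledArtinGroup.of_mul_of_comm]
    · congr 4 <;> ring
    · exact ⟨by simpa using hr₁', by dsimp only; linarith, Or.inl (by dsimp only; linarith)⟩
  · simp only [SemidirectProduct.mul_right, edgeValue, h₁, h₂, h₁', h₂', List.length_append]
    exact contractionAt_comm _ _ hr₁ hr₂ _

variable (P) in
/-- The values of the edges, as a functor on the fundamental groupoid of the Squier complex. -/
noncomputable def developFunctor : P.SquierGroupoid ⥤ SingleObj P.Developmentᵐᵒᵖ :=
  CategoryTheory.Quotient.lift _ P.skeletonFunctor <| by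
    rintro _ _ _ _ ⟨a, r, b, s, c, e₁, e₂, e₁', e₂', h₁, h₂, h₁', h₂'⟩
    refine (CategoryTheory.Functor.map_comp _ _ _).trans
      (Eq.trans ?_ (CategoryTheory.Functor.map_comp _ _ _).symm)
    rw [skeletonFunctor_edgeClass, skeletonFunctor_edgeClass, skeletonFunctor_edgeClass,
      skeletonFunctor_edgeClass]
    exact congrArg MulOpposite.op (edgeValue_square h₁ h₂ h₁' h₂')

/-- The value of an element of the fundamental groupoid in the development. -/
noncomputable def develop {x y : List α} (g : P.basepoint x ⟶ P.basepoint y) : P.Development :=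
  MulOpposite.unop (P.developFunctor.map g)

@[simp] theorem develop_id (x : List α) : develop (𝟙 (P.basepoint x)) = 1 :=
  congrArg MulOpposite.unop (P.developFunctor.map_id _)

@[simp] theorem develop_comp {x y z : List α} (g : P.basepoint x ⟶ P.basepoint y)
    (g' : P.basepoint y ⟶ P.basepoint z) : develop (g ≫ g') = develop g * develop g' :=
  congrArg MulOpposite.unop (P.developFunctor.map_comp g g')

theorem develop_edgeHom {x y : List α} (e : P.Edge x y) : develop (edgeHom e) = edgeValue e :=
  congrArg MulOpposite.unop (skeletonFunctor_edgeClass e)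

theorem develop_inv {x y : List α} (g : P.basepoint x ⟶ P.basepoint y) :
    develop (Groupoid.inv g) = (develop g)⁻¹ := by
  rw [← mul_eq_one_iff_eq_inv, ← develop_comp, Groupoid.inv_comp, develop_id]

namespace Move

theorem develop_hom_right {x y : List α} (m : P.Move x y) :
    (develop m.hom).right = contractionAt m.pre.length
      (((P.side m.rel (!m.sign)).length : ℤ) - (P.side m.rel m.sign).length) := by
  obtain ⟨a, r, _ | _, c, h, h'⟩ := m
  · simp only [hom, develop_inv, develop_edgeHom, SemidirectProduct.inv_right, edgeValue,
      contractionAt_inv, neg_sub]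
    rfl
  · simp only [hom, develop_edgeHom]
    rfl

/-- The generator of the right-angled Artin group given by the place of a directed edge, with the
direction as the exponent. The map `f` converts the coordinates of the source word to those of a
reference word, in which the interval is recorded. -/
def letter {x y : List α} (m : P.Move x y) (f : ℝ ≃o ℝ) : (P.rels × ℝ × ℝ) × Bool :=
  ((m.rel, f m.pre.length, f (m.pre.length + (P.side m.rel m.sign).length)), m.sign)

theorem develop_hom_left {x y : List α} (m : P.Move x y) (f : ℝ ≃o ℝ) :
    intervalGraph.aut P.rels f (develop m.hom).left =
      RightAngledArtinGroup.wordProd (intervalGraph P.rels) [m.letter f] := by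
  obtain ⟨a, r, _ | _, c, h, h'⟩ := m
  · have hr₁ : 0 < r.1.1.length := P.side_length_pos r true
    have hr₂ : 0 < r.1.2.length := P.side_length_pos r false
    simp only [hom, develop_inv, develop_edgeHom, SemidirectProduct.inv_left, edgeValue,
      contractionAt_inv, neg_sub, map_inv, intervalGraph.aut_of]
    rw [contractionAt_of_le _ le_rfl, contractionAt_of_ge _ hr₂ hr₁ le_rfl]
    simp [letter, side, add_sub_right_comm]
  · simp [hom, develop_edgeHom, edgeValue, letter, side]

end Move

end SemigroupPresentation

/-! ### Faithfulness of the development -/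

namespace SemigroupPresentation

open CategoryTheory RightAngledArtinGroup

variable {α : Type*} {P : SemigroupPresentation α}

/-- `Walk f g l`: the element `g` of the fundamental groupoid is the class of an edge path whose
edges, developed with initial coordinates `f`, spell the word `l`. -/
inductive Walk : (f : ℝ ≃o ℝ) → {x y : List α} → (P.basepoint x ⟶ P.basepoint y) →
    List ((P.rels × ℝ × ℝ) × Bool) → Prop
  | nil (f : ℝ ≃o ℝ) (x : List α) : Walk f (𝟙 (P.basepoint x)) []
  | cons (f : ℝ ≃o ℝ) {x y z : List α} (m : P.Move x y) {g : P.basepoint y ⟶ P.basepoint z}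
      {l : List ((P.rels × ℝ × ℝ) × Bool)} : Walk (f * (develop m.hom).right) g l →
      Walk f (m.hom ≫ g) (m.letter f :: l)

namespace Walk

/-- Every element `g` of the fundamental groupoid is the class of an edge path; the word it spells
represents the Artin component of `develop g`, transported by the initial coordinates. -/
theorem exists_walk {x y : List α} (g : P.basepoint x ⟶ P.basepoint y) :
    ∀ f : ℝ ≃o ℝ, ∃ l, Walk f g l ∧
      intervalGraph.aut P.rels f (develop g).left = wordProd (intervalGraph P.rels) l := by
  induction g using hom_induction with
  | id x => exact fun f => ⟨[], .nil f x, by simp⟩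
  | comp m g ih =>
    intro f
    obtain ⟨l, h, hl⟩ := ih (f * (develop m.hom).right)
    refine ⟨_, h.cons f m, ?_⟩
    rw [wordProd_cons, ← hl, develop_comp, SemidirectProduct.mul_left, map_mul,
      m.develop_hom_left f, map_mul, MulAut.mul_apply, wordProd_cons, wordProd_nil, mul_one]

theorem eq_of_nil {f : ℝ ≃o ℝ} {x : List α} {g : P.basepoint x ⟶ P.basepoint x}
    (h : Walk f g []) : g = 𝟙 _ := by
  cases h
  rfl

theorem cons_inv {f : ℝ ≃o ℝ} {x z : List α} {g : P.basepoint x ⟶ P.basepoint z}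
    {s : (P.rels × ℝ × ℝ) × Bool} {l : List ((P.rels × ℝ × ℝ) × Bool)} (h : Walk f g (s :: l)) :
    ∃ (y : List α) (m : P.Move x y) (g' : P.basepoint y ⟶ P.basepoint z), s = m.letter f ∧
      g = m.hom ≫ g' ∧ Walk (f * (develop m.hom).right) g' l := by
  cases h with
  | cons _ m h => exact ⟨_, m, _, rfl, rfl, h⟩

/-- Consecutive moves with adjacent letters take place in disjoint subwords, so they may be
exchanged across a square. -/
theorem exists_swap {x y z : List α} (f : ℝ ≃o ℝ) (m₁ : P.Move x y) (m₂ : P.Move y z)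
    (h : (intervalGraph P.rels).Adj (m₁.letter f).1
      (m₂.letter (f * (develop m₁.hom).right)).1) :
    ∃ (y' : List α) (m₂' : P.Move x y') (m₁' : P.Move y' z),
      m₁.hom ≫ m₂.hom = m₂'.hom ≫ m₁'.hom ∧
      m₂'.letter f = m₂.letter (f * (develop m₁.hom).right) ∧
      m₁'.letter (f * (develop m₂'.hom).right) = m₁.letter f := by
  have h₁ := P.side_length_pos m₁.rel m₁.sign
  have h₁' := P.side_length_pos m₁.rel (!m₁.sign)
  have h₂ := P.side_length_pos m₂.rel m₂.sign
  have h₂' := P.side_length_pos m₂.rel (!m₂.sign)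
  have e : (m₁.letter f).1.2.2 = (f * (develop m₁.hom).right)
      (m₁.pre.length + (P.side m₁.rel (!m₁.sign)).length) := by
    rw [RelIso.mul_apply, m₁.develop_hom_right, contractionAt_of_ge _ h₁ h₁' le_rfl]
    simp [Move.letter, add_sub_right_comm]
  have e' : (m₁.letter f).1.2.1 = (f * (develop m₁.hom).right) m₁.pre.length := by
    rw [RelIso.mul_apply, m₁.develop_hom_right, contractionAt_of_le _ le_rfl]
    rfl
  -- By `e` and `e'`, disjointness of the two intervals can be tested in the middle word `y`.
  obtain ⟨-, -, h⟩ := h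
  rw [e, e'] at h
  simp only [Move.letter, OrderIso.le_iff_le] at h
  rcases h with h | h
  · obtain ⟨b, hb⟩ : m₁.pre ++ P.side m₁.rel (!m₁.sign) <+: m₂.pre := by
      refine List.prefix_of_prefix_length_le (l₃ := y) ⟨_, m₁.target_eq.symm⟩
        ⟨_, (m₂.source_eq.trans (List.append_assoc ..)).symm⟩ ?_
      rw [List.length_append]
      exact_mod_cast h
    obtain ⟨y', m₂', m₁', hm, h₃, h₄, h₅, h₆, h₇, h₈⟩ := m₁.exists_square m₂ b hb.symm
    have hb₀ : (0 : ℝ) ≤ b.length := by positivity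
    have hm₂ : (0 : ℝ) ≤ (P.side m₂.rel m₂.sign).length := by positivity
    have hm₁ : (0 : ℝ) ≤ (P.side m₁.rel m₁.sign).length := by positivity
    refine ⟨y', m₂', m₁', hm, ?_, ?_⟩
    · simp only [Move.letter, RelIso.mul_apply, m₁.develop_hom_right, h₃, h₄, h₅, ← hb,
        List.length_append, Nat.cast_add]
      rw [contractionAt_of_ge _ h₁ h₁' (by linarith), contractionAt_of_ge _ h₁ h₁' (by linarith)]
      ring_nf
    · simp only [Move.letter, RelIso.mul_apply, m₂'.develop_hom_right, h₃, h₆, h₇, h₈]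
      rw [contractionAt_of_le _ (by push_cast [List.length_append]; linarith),
        contractionAt_of_le _ (by push_cast [List.length_append]; linarith)]
  · obtain ⟨b, hb⟩ : m₂.pre ++ P.side m₂.rel m₂.sign <+: m₁.pre := by
      refine List.prefix_of_prefix_length_le (l₃ := y) ⟨_, m₂.source_eq.symm⟩
        ⟨_, (m₁.target_eq.trans (List.append_assoc ..)).symm⟩ ?_
      rw [List.length_append]
      exact_mod_cast h
    obtain ⟨y', m₂', m₁', hm, h₃, h₄, h₅, h₆, h₇, h₈⟩ := m₁.exists_square' m₂ b hb.symm
    have hb₀ : (0 : ℝ) ≤ b.length := by positivity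
    have hm₂ : (0 : ℝ) ≤ (P.side m₂.rel m₂.sign).length := by positivity
    have hm₁ : (0 : ℝ) ≤ (P.side m₁.rel m₁.sign).length := by positivity
    refine ⟨y', m₂', m₁', hm, ?_, ?_⟩
    · simp only [Move.letter, RelIso.mul_apply, m₁.develop_hom_right, h₆, h₇, h₈]
      rw [contractionAt_of_le _ (by linarith), contractionAt_of_le _ h]
    · simp only [Move.letter, RelIso.mul_apply, m₂'.develop_hom_right, h₃, h₄, h₅, h₆, h₇, h₈, ← hb,
        List.length_append, Nat.cast_add]
      rw [contractionAt_of_ge _ h₂ h₂' (by linarith), contractionAt_of_ge _ h₂ h₂' (by linarith)]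
      ring_nf

/-- Consecutive moves with inverse letters are inverse to each other. -/
theorem eq_reverse {x y z : List α} (f : ℝ ≃o ℝ) (m₁ : P.Move x y) (m₂ : P.Move y z)
    (h : m₂.letter (f * (develop m₁.hom).right) = letterInv (m₁.letter f)) :
    ∃ hz : z = x, hz ▸ m₂ = m₁.reverse := by
  simp only [Move.letter, letterInv, Prod.mk.injEq, RelIso.mul_apply,
    EmbeddingLike.apply_eq_iff_eq] at h
  obtain ⟨⟨hr, hp, -⟩, hs⟩ := h
  -- The coordinate map of `m₁` fixes the left end point, so `m₂` rewrites at the same position.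
  nth_rw 1 [← contractionAt_of_le (((P.side m₁.rel (!m₁.sign)).length : ℤ) -
    (P.side m₁.rel m₁.sign).length) (le_refl (m₁.pre.length : ℝ))] at hp
  rw [m₁.develop_hom_right, EmbeddingLike.apply_eq_iff_eq, Nat.cast_inj] at hp
  obtain ⟨a, r, ε, c, h₁, rfl⟩ := m₁
  obtain ⟨a', r', ε', c', h₂, rfl⟩ := m₂
  dsimp only at hr hp hs
  subst hr hs
  rw [List.append_assoc, List.append_assoc] at h₂
  obtain ⟨rfl, h₂'⟩ := List.append_inj h₂ hp.symm
  obtain rfl : c = c' := List.append_cancel_left h₂'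
  subst h₁
  cases ε <;> exact ⟨rfl, rfl⟩

theorem reduction {l l' : List ((P.rels × ℝ × ℝ) × Bool)}
    (h : Reduction (intervalGraph P.rels) l l') : ∀ {f : ℝ ≃o ℝ} {x y : List α}
      {g : P.basepoint x ⟶ P.basepoint y}, Walk f g l → Walk f g l' := by
  induction h with
  | swap l h =>
    intro f x z g hw
    obtain ⟨y, m₁, g, rfl, rfl, hw₁⟩ := hw.cons_inv
    obtain ⟨z, m₂, g, rfl, rfl, hw₂⟩ := hw₁.cons_inv
    obtain ⟨y', m₂', m₁', hm, h₁, h₂⟩ := exists_swap f m₁ m₂ h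
    rw [← Category.assoc, hm, Category.assoc, ← h₁, ← h₂]
    refine .cons _ _ (.cons _ _ ?_)
    rwa [mul_assoc, ← SemidirectProduct.mul_right, ← develop_comp, ← hm, develop_comp,
      SemidirectProduct.mul_right, ← mul_assoc]
  | cancel s l =>
    intro f x z g hw
    obtain ⟨y, m₁, g, rfl, rfl, hw₁⟩ := hw.cons_inv
    obtain ⟨z, m₂, g, h₂, rfl, hw₂⟩ := hw₁.cons_inv
    obtain ⟨rfl, h⟩ := eq_reverse f m₁ m₂ h₂.symm
    obtain rfl : m₂ = m₁.reverse := h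
    have h₁ : m₁.hom ≫ m₁.reverse.hom = 𝟙 _ := by rw [Move.hom_reverse, Groupoid.comp_inv]
    rw [← Category.assoc, h₁, Category.id_comp]
    rwa [mul_assoc, ← SemidirectProduct.mul_right, ← develop_comp, h₁, develop_id,
      SemidirectProduct.one_right, mul_one] at hw₂
  | cons s h ih =>
    intro f x z g hw
    obtain ⟨y, m, g, rfl, rfl, hw₁⟩ := hw.cons_inv
    exact (ih hw₁).cons f m

end Walk

/-- A loop in the Squier complex with trivial Artin component is trivial. -/
theorem eq_id_of_develop_left_eq_one {x : List α} (g : P.basepoint x ⟶ P.basepoint x)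
    (h : (develop g).left = 1) : g = 𝟙 _ := by
  obtain ⟨l, hw, hl⟩ := Walk.exists_walk g 1
  rw [h, map_one] at hl
  have hr := reduction_nil_of_wordProd_eq_one hl.symm
  refine Walk.eq_of_nil (f := 1) ?_
  clear h hl
  induction hr using Relation.ReflTransGen.head_induction_on with
  | refl => exact hw
  | head h _ ih => exact ih (Walk.reduction h hw)

/-- The coordinate change of an element of the fundamental groupoid is dyadic piecewise linear; it
is the identity to the left of `0` and the translation that matches the right end points of the
words to the right of the target word. -/
theorem develop_right_mem {x y : List α} (g : P.basepoint x ⟶ P.basepoint y) :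
    (develop g).right ∈ dyadicPL ∧ (∀ t ≤ 0, (develop g).right t = t) ∧
      ∀ t, (y.length : ℝ) ≤ t → (develop g).right t = t + x.length - y.length := by
  induction g using hom_induction with
  | id x => exact ⟨one_mem _, fun _ _ => rfl, fun t _ => by simp⟩
  | @comp x y z m g ih =>
    obtain ⟨ih₀, ih₁, ih₂⟩ := ih
    have hx : (x.length : ℝ) = m.pre.length + (P.side m.rel m.sign).length + m.suf.length := by
      simpa [← add_assoc] using congrArg (fun l => (l.length : ℝ)) m.source_eq
    have hy : (y.length : ℝ) = m.pre.length + (P.side m.rel (!m.sign)).length + m.suf.length := by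
      simpa [← add_assoc] using congrArg (fun l => (l.length : ℝ)) m.target_eq
    have hs : (0 : ℝ) ≤ m.suf.length := by positivity
    have hp : (0 : ℝ) ≤ m.pre.length := by positivity
    rw [develop_comp, SemidirectProduct.mul_right, m.develop_hom_right]
    refine ⟨mul_mem (contractionAt_mem_dyadicPL _ _) ih₀, fun t ht => ?_, fun t ht => ?_⟩
    · rw [RelIso.mul_apply, ih₁ t ht, contractionAt_of_le _ (ht.trans hp)]
    · rw [RelIso.mul_apply, ih₂ t ht, contractionAt_of_ge _ (P.side_length_pos _ _)
        (P.side_length_pos _ _) (by linarith)]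
      linarith

/-! ### The extension -/

/-- The restriction of the development to a diagram group. -/
noncomputable def developHom (w : List α) : P.DiagramGroup w →* P.Development where
  toFun := develop
  map_one' := develop_id w
  map_mul' := develop_comp

/-- The coordinate map of an element of the diagram group, conjugated by the power of the
contraction that maps `[0, |w|]` to `[0, 1]`. -/
noncomputable def toUnit {w : List α} (hw : w ≠ []) : P.DiagramGroup w →* dyadicPLUnit :=
  ((MulAut.conj (contraction ^ ((w.length : ℤ) - (1 : ℕ)))).toMonoidHom.comp
    (SemidirectProduct.rightHom.comp (developHom w))).codRestrict dyadicPLUnit <| by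
    intro g
    obtain ⟨h₀, h₁, h₂⟩ := develop_right_mem g
    have hl : 0 < w.length := List.length_pos_iff.2 hw
    have hc := zpow_mem contraction_mem_dyadicPL ((w.length : ℤ) - (1 : ℕ))
    refine ⟨mul_mem (mul_mem hc h₀) (inv_mem hc), fun t ht => ?_, fun t ht => ?_⟩
    · change (contraction ^ ((w.length : ℤ) - (1 : ℕ))) ((develop g).right
        ((contraction ^ ((w.length : ℤ) - (1 : ℕ)))⁻¹ t)) = t
      rw [← zpow_neg, contraction_zpow_of_nonpos _ ht, h₁ t ht, contraction_zpow_of_nonpos _ ht]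
    · change (contraction ^ ((w.length : ℤ) - (1 : ℕ))) ((develop g).right
        ((contraction ^ ((w.length : ℤ) - (1 : ℕ)))⁻¹ t)) = t
      rw [h₂, add_sub_cancel_right, RelIso.apply_inv_self]
      rw [← zpow_neg, neg_sub, contraction_zpow_of_le hl one_pos (by simpa using ht)]
      push_cast
      linarith

theorem toUnit_eq_one_iff {w : List α} (hw : w ≠ []) (g : P.DiagramGroup w) :
    toUnit hw g = 1 ↔ (develop g).right = 1 := by
  rw [Subtype.ext_iff]
  exact map_eq_one_iff _ (MulAut.conj (contraction ^ ((w.length : ℤ) - (1 : ℕ)))).injective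

end SemigroupPresentation

open SemigroupPresentation in
theorem mainTheorem2 (G : Type v) [Group G] (hG : IsDiagramGroup.{u, v} G) :
    ∃ (V : Type u) (Γ : SimpleGraph V) (R : Subgroup (RightAngledArtinGroup Γ))
      (S : Subgroup ThompsonF), Nonempty (GroupExtension R G S) := by
  obtain ⟨α, P, w, hw, ⟨φ⟩⟩ := hG
  -- `R` is the image of the kernel of `ρ` under the label homomorphism, and `S` the image of `ρ`.
  let ρ : G →* ThompsonF := (dyadicPLUnit.toThompsonF.comp (toUnit hw)).comp φ.toMonoidHom
  have hρ : ∀ g, g ∈ ρ.ker ↔ (develop (φ g)).right = 1 := fun g =>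
    MonoidHom.mem_ker.trans <| (map_eq_one_iff _ dyadicPLUnit.toThompsonF_injective).trans
      (toUnit_eq_one_iff hw _)
  let lam : ρ.ker →* RightAngledArtinGroup (intervalGraph P.rels) :=
    { toFun := fun g => (develop (φ g)).left
      map_one' := by
        rw [OneMemClass.coe_one, map_one]
        exact congrArg SemidirectProduct.left (develop_id w)
      map_mul' := fun g h => by
        rw [Subgroup.coe_mul, map_mul]
        refine (congrArg SemidirectProduct.left (develop_comp _ _)).trans ?_
        rw [SemidirectProduct.mul_left, (hρ g).1 g.2, map_one, MulAut.one_apply] }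
  have hlam : Function.Injective lam := (injective_iff_map_eq_one _).2 fun g hg =>
    Subtype.ext <| (map_eq_one_iff φ φ.injective).1 (eq_id_of_develop_left_eq_one _ hg)
  refine ⟨P.rels × ℝ × ℝ, intervalGraph P.rels, lam.range, ρ.range, ⟨?_⟩⟩
  exact
    { inl := ρ.ker.subtype.comp (MonoidHom.ofInjective hlam).symm.toMonoidHom
      rightHom := ρ.rangeRestrict
      inl_injective := ρ.ker.subtype_injective.comp (MonoidHom.ofInjective hlam).symm.injective
      range_inl_eq_ker_rightHom := by
        rw [MonoidHom.range_comp, MonoidHom.range_eq_top.2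
          (MonoidHom.ofInjective hlam).symm.surjective, ← MonoidHom.range_eq_map,
          Subgroup.range_subtype, MonoidHom.ker_rangeRestrict]
      rightHom_surjective := ρ.rangeRestrict_surjective }
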